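/- For complex $a,b,c$ let $\frac{1}{\Gamma(c)}\,{}_2F_1(a,b;c;z)$ denote the sum $\sum_{n\ge 0}\frac{(a)_n(b)_n}{\Gamma(c+n)\,n!}z^n$ for $|z|<1$ (with $1/\Gamma=0$ at the poles of $\Gamma$, so that $c\in\{0,-1,-2,\dots\}$ is allowed), and elsewhere its analytic continuation along the segment from $0$ to $z$. For $\nu,\mu\in\mathbb C$ and $x\in(-1,1)$ the Ferrers function of the first kind is $$\mathsf P_\nu^{-\mu}(x)=\frac{1}{\Gamma(\mu+1)}\left(\frac{1-x}{1+x}\right)^{\mu/2}{}_2F_1\!\left(-\nu,\nu+1;\mu+1;\frac{1-x}{2}\right).$$ All powers are principal values. **Theorem.** Let $\nu,\mu\in\mathbb C$ and consider the formula $$\mathsf P_\nu^{-\mu}(x)=\frac{x^{\nu-\mu}(1-x^2)^{\mu/2}}{2^\mu\,\Gamma(\mu+1)}\;{}_2F_1\!\left(\frac{\mu-\nu}{2},\frac{\mu-\nu+1}{2};\mu+1;1-\frac1{x^2}\right).\qquad(*)$$ 1. $(*)$ holds for all $x\in(0,1)$. 2. The right-hand side of $(*)$, as a function of $x\in(0,1)$,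 has a real-analytic continuation $R$ to $(-1,1)$, and for every such continuation $\mathsf P_\nu^{-\mu}(x)=R(x)$ for all $x\in(-1,1)$. That is, $(*)$ holds on $(-1,1)$ with its right-hand side understood by analytic continuation in $x$. 3. If $\nu-\mu\in\{0,1,2,\dots\}$, then $(*)$ holds as written for all $x\in(-1,1)$, $x\neq0$. -/

import Mathlib

noncomputable section

namespace Ferrers

/-- `w` is the value at `z` obtained by analytic continuation, along the straight segment from `0`
to `z`, of the germ of `f` at `0`. -/
def IsRadialValue (f : ℂ → ℂ) (z w : ℂ) : Prop :=
  ∃ G : ℂ → ℂ, AnalyticOnNhd ℂ G (segment ℝ 0 z) ∧ G =ᶠ[nhds 0] f ∧ G z = w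

theorem IsRadialValue.unique {f : ℂ → ℂ} {z w w' : ℂ}
    (h : IsRadialValue f z w) (h' : IsRadialValue f z w') : w = w' := by
  obtain ⟨G, hG, hf, rfl⟩ := h
  obtain ⟨G', hG', hf', rfl⟩ := h'
  exact hG.eqOn_of_preconnected_of_eventuallyEq hG' (convex_segment 0 z).isPreconnected
    (left_mem_segment ℝ 0 z) (hf.trans hf'.symm) (right_mem_segment ℝ 0 z)

open Classical in
/-- Analytic continuation of the germ of `f` at `0` to `z` along the segment from `0` to `z`
(with the junk value `0` if this continuation does not exist). For the Gauss series this is the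
principal branch on `ℂ` cut along `[1, ∞)`. -/
def radialContinuation (f : ℂ → ℂ) (z : ℂ) : ℂ :=
  if h : ∃ w, IsRadialValue f z w then h.choose else 0

theorem IsRadialValue.eq {f : ℂ → ℂ} {z w : ℂ} (h : IsRadialValue f z w) :
    radialContinuation f z = w := by
  have hex : ∃ w, IsRadialValue f z w := ⟨w, h⟩
  rw [radialContinuation, dif_pos hex]
  exact hex.choose_spec.unique h

theorem IsRadialValue.const_mul {f : ℂ → ℂ} {z w : ℂ} (h : IsRadialValue f z w) (k : ℂ) :
    IsRadialValue (fun t => k * f t) z (k * w) := by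
  obtain ⟨G, hG, hf, rfl⟩ := h
  refine ⟨fun t => k * G t, fun t ht => analyticAt_const.mul (hG t ht), ?_, rfl⟩
  filter_upwards [hf] with t ht
  rw [ht]

theorem radialContinuation_const_mul {k : ℂ} (hk : k ≠ 0) (f : ℂ → ℂ) (z : ℂ) :
    radialContinuation (fun t => k * f t) z = k * radialContinuation f z := by
  by_cases h : ∃ w, IsRadialValue f z w
  · obtain ⟨w, hw⟩ := h
    rw [hw.eq, (hw.const_mul k).eq]
  · have h' : ¬ ∃ w, IsRadialValue (fun t => k * f t) z w := by
      rintro ⟨w, hw⟩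
      refine h ⟨k⁻¹ * w, ?_⟩
      simpa [inv_mul_cancel_left₀ hk] using hw.const_mul k⁻¹
    rw [radialContinuation, radialContinuation, dif_neg h, dif_neg h', mul_zero]

/-- The Gauss hypergeometric function `₂F₁(a, b; c; z)`: the sum of the Gauss series, and elsewhere
its analytic continuation. -/
def hyp (a b c z : ℂ) : ℂ :=
  radialContinuation (fun t => ordinaryHypergeometric a b c t) z

/-- The function `₂F₁(a, b; c; z) / Γ(c)`, which makes sense for every complex `c`: the sum of
`∑ (a)ₙ (b)ₙ / (Γ(c + n) n!) zⁿ`, where `1 / Γ` vanishes at the poles of `Γ`, and elsewhere its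
analytic continuation. -/
def hypOverGamma (a b c z : ℂ) : ℂ :=
  radialContinuation (Complex.regularizedGaussHGFun a b c) z

theorem hypOverGamma_eq {a b c : ℂ} (hc : ∀ k : ℕ, c ≠ -k) (z : ℂ) :
    hypOverGamma a b c z = hyp a b c z / Complex.Gamma c := by
  have h : Complex.regularizedGaussHGFun a b c
      = fun t => (Complex.Gamma c)⁻¹ * ordinaryHypergeometric a b c t := by
    funext t
    rw [← Complex.ordinaryHypergeometric_div_Gamma_eq hc, div_eq_inv_mul]
  rw [hypOverGamma, h, radialContinuation_const_mul (inv_ne_zero (Complex.Gamma_ne_zero hc)),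
    hyp, div_eq_inv_mul]

theorem hypOverGamma_eq_series (a b c : ℂ) {z : ℂ} (hz : ‖z‖ < 1) :
    hypOverGamma a b c z = Complex.regularizedGaussHGFun a b c z := by
  have hr := Complex.radius_regularizedGaussHGFunSeries_ge_one a b c
  have han : AnalyticOnNhd ℂ (Complex.regularizedGaussHGFun a b c) (Metric.ball 0 1) := by
    have h := (Complex.regularizedGaussHGFunSeries a b c).hasFPowerSeriesOnBall
      (lt_of_lt_of_le one_pos hr)
    intro t ht
    refine h.analyticAt_of_mem (Metric.eball_subset_eball hr ?_)
    simpa [← Metric.eball_ofReal] using ht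
  refine IsRadialValue.eq ⟨_, han.mono ?_, Filter.EventuallyEq.rfl, rfl⟩
  exact (convex_ball (0 : ℂ) 1).segment_subset (by simp) (by simpa using hz)

/-- The Ferrers function of the first kind `𝖯_ν^{-μ}(x)`, `-1 < x < 1`. Note that the second
argument `μ` is minus the order. -/
def ferrersP (ν μ : ℂ) (x : ℝ) : ℂ :=
  (((1 - x) / (1 + x) : ℝ) : ℂ) ^ (μ / 2) *
    hypOverGamma (-ν) (ν + 1) (μ + 1) (((1 - x) / 2 : ℝ) : ℂ)

/-- `x^{ν-μ} (1-x²)^{μ/2} / (2^μ Γ(μ+1)) · ₂F₁((μ-ν)/2, (μ-ν+1)/2; μ+1; 1-1/x²)`, with principal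
values of all powers, for real `x ≠ 0`, `-1 < x < 1`. -/
def quadraticRepr (ν μ : ℂ) (x : ℝ) : ℂ :=
  (x : ℂ) ^ (ν - μ) * ((1 - x ^ 2 : ℝ) : ℂ) ^ (μ / 2) / (2 : ℂ) ^ μ *
    hypOverGamma ((μ - ν) / 2) ((μ - ν + 1) / 2) (μ + 1) ((1 - 1 / x ^ 2 : ℝ) : ℂ)

/-- `R` is the analytic continuation to `(-1, 1)` of the function `g` on `(0, 1)`. -/
def IsContinuation (g R : ℝ → ℂ) : Prop :=
  AnalyticOnNhd ℝ R (Set.Ioo (-1) 1) ∧ Set.EqOn R g (Set.Ioo 0 1)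

end Ferrers

end

namespace Ferrers

open Filter Topology Complex

/-! Put t = (1-x)/2. Then 1-t = (1+x)/2, 1-2t = x and -4t(1-t)/(1-2t)² = 1 - 1/x², so (*) is a
quadratic transformation of Gauss functions in t. By `GaussODE.quadratic` both of its sides solve
the same Gauss equation near t = 0. The exponents there are 0 and -μ, so an analytic solution is
fixed by its leading coefficient (`GaussODE.eventuallyEq`). For μ = -N with N ≥ 1 both sides start
at t^N, and the coefficients agree by Pochhammer duplication.

To reach every x in (0,1), solve the transformation for the function of z = 1 - 1/x²
(`isRadialValue_quadratic`): along the whole segment from 0 to z the corresponding t stays in [0,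
1/2), where the series in t converges. The Ferrers function is itself analytic on (-1,1), so it is
the required continuation, and the identity theorem gives uniqueness. If ν - μ is a natural number,
the series in z terminates and the formula is analytic through x = 0 after simplification. -/

/-! ### Power series on the unit disc -/

theorem mem_eball_zero_one {z : ℂ} (hz : ‖z‖ < 1) : z ∈ Metric.eball (0 : ℂ) 1 := by
  rw [Metric.mem_eball, edist_zero_right, ← ofReal_norm]
  exact ENNReal.ofReal_lt_one.2 hz

theorem hasFPowerSeriesOnBall_regularizedGaussHGFun (a b c : ℂ) :
    HasFPowerSeriesOnBall (regularizedGaussHGFun a b c) (regularizedGaussHGFunSeries a b c) 0 1 :=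
  ((regularizedGaussHGFunSeries a b c).hasFPowerSeriesOnBall
    (lt_of_lt_of_le one_pos (radius_regularizedGaussHGFunSeries_ge_one a b c))).mono one_pos
    (radius_regularizedGaussHGFunSeries_ge_one a b c)

theorem analyticAt_regularizedGaussHGFun (a b c : ℂ) {z : ℂ} (hz : ‖z‖ < 1) :
    AnalyticAt ℂ (regularizedGaussHGFun a b c) z :=
  (hasFPowerSeriesOnBall_regularizedGaussHGFun a b c).analyticAt_of_mem (mem_eball_zero_one hz)

theorem hasSum_of_hasFPowerSeriesOnBall {f : ℂ → ℂ} {p : FormalMultilinearSeries ℂ ℂ ℂ}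
    (h : HasFPowerSeriesOnBall f p 0 1) {z : ℂ} (hz : ‖z‖ < 1) :
    HasSum (fun n => p.coeff n * z ^ n) (f z) := by
  have := h.hasSum (y := z) (mem_eball_zero_one hz)
  simpa [FormalMultilinearSeries.apply_eq_pow_smul_coeff, mul_comm] using this

theorem exists_hasFPowerSeriesOnBall_deriv {f : ℂ → ℂ} {p : FormalMultilinearSeries ℂ ℂ ℂ}
    (h : HasFPowerSeriesOnBall f p 0 1) :
    ∃ q : FormalMultilinearSeries ℂ ℂ ℂ, HasFPowerSeriesOnBall (deriv f) q 0 1 ∧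
      ∀ n, q.coeff n = (n + 1) * p.coeff (n + 1) := by
  refine ⟨(ContinuousLinearMap.apply ℂ ℂ (1 : ℂ)).compFormalMultilinearSeries p.derivSeries,
    (ContinuousLinearMap.apply ℂ ℂ (1 : ℂ)).comp_hasFPowerSeriesOnBall h.fderiv, fun n => ?_⟩
  have := p.derivSeries_coeff_one n
  simp only [FormalMultilinearSeries.coeff] at this ⊢
  simp

/-! ### The Gauss equation and uniqueness of its analytic solutions -/

/-- The Gauss differential equation holds at `z`. -/
def GaussODE (a b c : ℂ) (f : ℂ → ℂ) (z : ℂ) : Prop :=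
  z * (1 - z) * deriv (deriv f) z + (c - (a + b + 1) * z) * deriv f z - a * b * f z = 0

/-- The factor c + n is kept on the left so that the recurrence survives c + n = 0, where 1/Γ(c+n)
makes the right side vanish too. -/
theorem coeff_regularizedGaussHGFunSeries_succ (a b c : ℂ) (n : ℕ) :
    (n + 1) * (c + n) * (regularizedGaussHGFunSeries a b c).coeff (n + 1) =
      (a + n) * (b + n) * (regularizedGaussHGFunSeries a b c).coeff n := by
  simp only [coeff_regularizedGaussHGFunSeries]
  rcases eq_or_ne (c + n) 0 with h | h
  · simp [h]
  · have hG : Gamma (c + (n + 1 : ℕ)) = (c + n) * Gamma (c + n) := by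
      rw [← Gamma_add_one _ h]; push_cast; ring_nf
    rw [hG, ascPochhammer_succ_eval, ascPochhammer_succ_eval, Nat.factorial_succ]
    rcases eq_or_ne (Gamma (c + n)) 0 with hg | hg
    · simp [hg]
    · have h1 : (n + 1 : ℂ) ≠ 0 := by exact_mod_cast n.succ_ne_zero
      have h2 : (n.factorial : ℂ) ≠ 0 := by exact_mod_cast n.factorial_ne_zero
      push_cast
      field_simp

theorem gaussODE_regularizedGaussHGFun (a b c : ℂ) {z : ℂ} (hz : ‖z‖ < 1) :
    GaussODE a b c (regularizedGaussHGFun a b c) z := by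
  have h0 := hasFPowerSeriesOnBall_regularizedGaussHGFun a b c
  obtain ⟨q, h1, hq⟩ := exists_hasFPowerSeriesOnBall_deriv h0
  obtain ⟨r, h2, hr⟩ := exists_hasFPowerSeriesOnBall_deriv h1
  have s0 := hasSum_of_hasFPowerSeriesOnBall h0 hz
  have s1 := hasSum_of_hasFPowerSeriesOnBall h1 hz
  have s2 := hasSum_of_hasFPowerSeriesOnBall h2 hz
  have rec' := coeff_regularizedGaussHGFunSeries_succ a b c
  set u := (regularizedGaussHGFunSeries a b c).coeff
  -- Each term of the equation is rewritten as a series in z^n; the factors n and n(n-1) supply the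
  -- zero terms needed for the index shifts. The coefficient of z^n is then the recurrence.
  have t1 : HasSum (fun n : ℕ => (n : ℂ) * u n * z ^ n)
      (z * deriv (regularizedGaussHGFun a b c) z) := by
    rw [← hasSum_nat_add_iff' 1]
    convert! s1.mul_left z using 1
    · ext n; rw [hq]; push_cast; ring
    · simp
  have t2 : HasSum (fun n : ℕ => (n : ℂ) * ((n + 1) * u (n + 1)) * z ^ n)
      (z * deriv (deriv (regularizedGaussHGFun a b c)) z) := by
    rw [← hasSum_nat_add_iff' 1]
    convert! s2.mul_left z using 1
    · ext n; rw [hr, hq]; push_cast; ring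
    · simp
  have t3 : HasSum (fun n : ℕ => (n : ℂ) * (n - 1) * u n * z ^ n)
      (z ^ 2 * deriv (deriv (regularizedGaussHGFun a b c)) z) := by
    rw [← hasSum_nat_add_iff' 2]
    convert! s2.mul_left (z ^ 2) using 1
    · ext n; rw [hr, hq]; push_cast; ring_nf
    · simp [Finset.sum_range_succ]
  have T := (((t2.sub t3).add (s1.mul_left c)).sub (t1.mul_left (a + b + 1))).sub
    (s0.mul_left (a * b))
  have hz0 : ∀ n : ℕ, (n : ℂ) * ((n + 1) * u (n + 1)) * z ^ n - (n : ℂ) * (n - 1) * u n * z ^ n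
      + c * (q.coeff n * z ^ n) - (a + b + 1) * ((n : ℂ) * u n * z ^ n)
      - a * b * (u n * z ^ n) = 0 := by
    intro n
    rw [hq]
    linear_combination z ^ n * rec' n
  simp only [hz0] at T
  have := T.unique hasSum_zero
  rw [GaussODE]
  linear_combination this

theorem GaussODE.sub {a b c : ℂ} {f g : ℂ → ℂ} (hf : AnalyticAt ℂ f 0) (hg : AnalyticAt ℂ g 0)
    (h1 : ∀ᶠ z in 𝓝 0, GaussODE a b c f z) (h2 : ∀ᶠ z in 𝓝 0, GaussODE a b c g z) :
    ∀ᶠ z in 𝓝 0, GaussODE a b c (f - g) z := by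
  have e : ∀ᶠ z in 𝓝 0, deriv (f - g) z = (deriv f - deriv g) z := by
    filter_upwards [hf.eventually_analyticAt, hg.eventually_analyticAt] with z h3 h4
    exact deriv_sub h3.differentiableAt h4.differentiableAt
  filter_upwards [h1, h2, e.eventually_nhds, hf.eventually_analyticAt,
    hg.eventually_analyticAt] with z h1 h2 h3 h4 h5
  have e2 : deriv (deriv (f - g)) z = deriv (deriv f) z - deriv (deriv g) z := by
    rw [EventuallyEq.deriv_eq h3]
    exact deriv_sub h4.deriv.differentiableAt h5.deriv.differentiableAt
  rw [GaussODE] at *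
  rw [e2, h3.self_of_nhds]
  simp only [Pi.sub_apply]
  linear_combination h1 - h2

/-- The exponent of the leading term of a nonzero analytic solution is `0` or `1 - c`. -/
theorem GaussODE.eventuallyEq_zero {a b c : ℂ} {N : ℕ} (hc : ∀ k : ℕ, N ≤ k → c ≠ -k) {h : ℂ → ℂ}
    (hh : AnalyticAt ℂ h 0) (hN : (N + 1 : ℕ) ≤ analyticOrderAt h 0)
    (hode : ∀ᶠ z in 𝓝 0, GaussODE a b c h z) : h =ᶠ[𝓝 0] 0 := by
  by_contra hne
  have htop : analyticOrderAt h 0 ≠ ⊤ := fun ht => hne (analyticOrderAt_eq_top.1 ht)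
  obtain ⟨n, hn⟩ := ENat.ne_top_iff_exists.1 htop
  obtain ⟨g, hg, hg0, hhg⟩ := (hh.analyticOrderAt_eq_natCast (n := n)).1 hn.symm
  rw [← hn] at hN
  have hNn : N + 1 ≤ n := by exact_mod_cast hN
  obtain ⟨m, rfl⟩ : ∃ m, n = m + 1 := ⟨n - 1, by omega⟩
  simp only [sub_zero, smul_eq_mul] at hhg
  have d1 : ∀ᶠ z in 𝓝 (0 : ℂ), deriv h z = z ^ m * ((m + 1) * g z + z * deriv g z) := by
    filter_upwards [hhg.eventually_nhds, hg.eventually_analyticAt] with z h1 h2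
    rw [EventuallyEq.deriv_eq h1]
    have := (hasDerivAt_pow (m + 1) z).fun_mul h2.differentiableAt.hasDerivAt
    rw [this.deriv]
    push_cast
    ring
  have d2 : ∀ᶠ z in 𝓝 (0 : ℂ), z * deriv (deriv h) z =
      z ^ m * (m * ((m + 1) * g z + z * deriv g z) +
        z * ((m + 1) * deriv g z + (deriv g z + z * deriv (deriv g) z))) := by
    filter_upwards [d1.eventually_nhds, hg.eventually_analyticAt] with z h1 h2
    rw [EventuallyEq.deriv_eq h1]
    have h3 := h2.differentiableAt.hasDerivAt
    have h4 := h2.deriv.differentiableAt.hasDerivAt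
    have := (hasDerivAt_pow m z).fun_mul
      ((h3.const_mul ((m : ℂ) + 1)).fun_add ((hasDerivAt_id' z).fun_mul h4))
    rw [this.deriv]
    rcases m with _ | m
    · simp
    · push_cast
      ring
  -- `Q` is the equation for h = z^(m+1) g divided by z^m. The division is valid only off 0, so Q 0
  -- = 0 follows by continuity; Q 0 is g 0 times the indicial polynomial at m + 1.
  set Q : ℂ → ℂ := fun z => (1 - z) * (m * ((m + 1) * g z + z * deriv g z) +
        z * ((m + 1) * deriv g z + (deriv g z + z * deriv (deriv g) z))) +
        (c - (a + b + 1) * z) * ((m + 1) * g z + z * deriv g z) - a * b * (z * g z) with hQ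
  have hQ0 : ∀ᶠ z in 𝓝[≠] (0 : ℂ), Q z = 0 := by
    filter_upwards [(hode.and (d1.and (d2.and hhg))).filter_mono nhdsWithin_le_nhds,
      self_mem_nhdsWithin] with z ⟨h1, h2, h3, h4⟩ h5
    have hz : z ^ m ≠ 0 := pow_ne_zero _ h5
    apply mul_left_cancel₀ hz
    rw [GaussODE, h2, h4] at h1
    rw [hQ]
    linear_combination h1 - (1 - z) * h3
  have hQc : ContinuousAt Q 0 := by
    have := hg.continuousAt
    have := hg.deriv.continuousAt
    have := hg.deriv.deriv.continuousAt
    fun_prop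
  have hlim : Tendsto Q (𝓝[≠] 0) (𝓝 (Q 0)) := hQc.tendsto.mono_left nhdsWithin_le_nhds
  have : Q 0 = 0 := tendsto_nhds_unique (hlim.congr' hQ0) tendsto_const_nhds
  have h6 : (m + 1 : ℂ) * (c + m) * g 0 = 0 := by
    simp only [hQ] at this
    linear_combination this
  have h7 : (m + 1 : ℂ) ≠ 0 := by exact_mod_cast m.succ_ne_zero
  have h8 : c + m ≠ 0 := fun h => hc m (by omega) (eq_neg_of_add_eq_zero_left h)
  exact (mul_ne_zero (mul_ne_zero h7 h8) hg0) h6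

/-- The difference vanishes to order above N, while `hc` says that the exponent 1 - c is not an
integer above N. The case N = 0 serves generic c, and N > 0 serves c = 1 - N. -/
theorem GaussODE.eventuallyEq {a b c : ℂ} {N : ℕ} (hc : ∀ k : ℕ, N ≤ k → c ≠ -k)
    {f₁ f₂ g₁ g₂ : ℂ → ℂ} (hg₁ : AnalyticAt ℂ g₁ 0) (hg₂ : AnalyticAt ℂ g₂ 0)
    (h₁ : ∀ᶠ z in 𝓝 0, f₁ z = z ^ N * g₁ z) (h₂ : ∀ᶠ z in 𝓝 0, f₂ z = z ^ N * g₂ z)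
    (h0 : g₁ 0 = g₂ 0) (ode₁ : ∀ᶠ z in 𝓝 0, GaussODE a b c f₁ z)
    (ode₂ : ∀ᶠ z in 𝓝 0, GaussODE a b c f₂ z) : f₁ =ᶠ[𝓝 0] f₂ := by
  have hp : AnalyticAt ℂ (fun z : ℂ => z ^ N) 0 := by fun_prop
  have hf₁ : AnalyticAt ℂ f₁ 0 := (hp.mul hg₁).congr (h₁.mono fun z hz => hz.symm)
  have hf₂ : AnalyticAt ℂ f₂ 0 := (hp.mul hg₂).congr (h₂.mono fun z hz => hz.symm)
  have hg : AnalyticAt ℂ (g₁ - g₂) 0 := hg₁.sub hg₂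
  have hg1 : ((1 : ℕ) : ℕ∞) ≤ analyticOrderAt (g₁ - g₂) 0 := by
    rw [Nat.cast_one, Order.one_le_iff_ne_zero, hg.analyticOrderAt_ne_zero]
    simp [h0]
  obtain ⟨k, hk, hgk⟩ := (natCast_le_analyticOrderAt hg).1 hg1
  have hord : (N + 1 : ℕ) ≤ analyticOrderAt (f₁ - f₂) 0 := by
    rw [natCast_le_analyticOrderAt (hf₁.sub hf₂)]
    refine ⟨k, hk, ?_⟩
    filter_upwards [h₁, h₂, hgk] with z e1 e2 e3
    simp only [Pi.sub_apply, smul_eq_mul, sub_zero, pow_one] at e3 ⊢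
    rw [e1, e2, pow_succ]
    linear_combination z ^ N * e3
  have := GaussODE.eventuallyEq_zero hc (hf₁.sub hf₂) hord (GaussODE.sub hf₁ hf₂ ode₁ ode₂)
  filter_upwards [this] with z hz
  exact sub_eq_zero.1 hz

/-! ### The quadratic change of variables in the Gauss equation -/

/-- Written as the function times its logarithmic derivative, so that the prefactor comes out of the
whole equation as a common factor. -/
theorem hasDerivAt_cpow_mul_cpow (μ κ : ℂ) {t : ℂ} (h1 : 1 - t ∈ slitPlane)
    (h2 : 1 - 2 * t ∈ slitPlane) :
    HasDerivAt (fun t : ℂ => (1 - t) ^ μ * (1 - 2 * t) ^ κ)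
      ((1 - t) ^ μ * (1 - 2 * t) ^ κ * (-μ / (1 - t) - 2 * κ / (1 - 2 * t))) t := by
  have d1 := ((hasDerivAt_id' t).const_sub 1).cpow_const (c := μ) h1
  have d2 := (((hasDerivAt_id' t).const_mul 2).const_sub 1).cpow_const (c := κ) h2
  refine (d1.fun_mul d2).congr_deriv ?_
  have n1 := slitPlane_ne_zero h1
  have n2 := slitPlane_ne_zero h2
  rw [cpow_sub _ _ n1, cpow_sub _ _ n2, cpow_one, cpow_one]
  field_simp
  ring

theorem hasDerivAt_quadraticArgument {t : ℂ} (h2 : 1 - 2 * t ≠ 0) :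
    HasDerivAt (fun t : ℂ => -4 * t * (1 - t) / (1 - 2 * t) ^ 2) (-4 / (1 - 2 * t) ^ 3) t := by
  have d1 := (((hasDerivAt_id' t).const_mul (-4)).fun_mul ((hasDerivAt_id' t).const_sub 1)).fun_div
    ((((hasDerivAt_id' t).const_mul 2).const_sub 1).fun_pow 2) (pow_ne_zero 2 h2)
  refine d1.congr_deriv ?_
  generalize hs : 1 - 2 * t = s at *
  field_simp
  rw [← hs]
  push_cast
  ring

/-- The quadratic change of variables turns the equation of the right side into that of the left. -/
theorem GaussODE.quadratic {ν μ : ℂ} {F : ℂ → ℂ} {t : ℂ} (h1 : 1 - t ∈ slitPlane)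
    (h2 : 1 - 2 * t ∈ slitPlane)
    (hF : AnalyticAt ℂ F (-4 * t * (1 - t) / (1 - 2 * t) ^ 2))
    (ode : GaussODE ((μ - ν) / 2) ((μ - ν + 1) / 2) (μ + 1) F
      (-4 * t * (1 - t) / (1 - 2 * t) ^ 2)) :
    GaussODE (-ν) (ν + 1) (μ + 1) (fun t => (1 - t) ^ μ * (1 - 2 * t) ^ (ν - μ) *
      F (-4 * t * (1 - t) / (1 - 2 * t) ^ 2)) t := by
  set φ : ℂ → ℂ := fun t => -4 * t * (1 - t) / (1 - 2 * t) ^ 2 with hφ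
  set P : ℂ → ℂ := fun t => (1 - t) ^ μ * (1 - 2 * t) ^ (ν - μ) with hP
  set L : ℂ → ℂ := fun t => -μ / (1 - t) - 2 * (ν - μ) / (1 - 2 * t) with hL
  have n1 := slitPlane_ne_zero h1
  have n2 := slitPlane_ne_zero h2
  have hφc : ContinuousAt φ t := (hasDerivAt_quadraticArgument n2).continuousAt
  have dF : ∀ {s : ℂ}, 1 - s ∈ slitPlane → 1 - 2 * s ∈ slitPlane → AnalyticAt ℂ F (φ s) →
      HasDerivAt (fun t => P t * F (φ t))
        (P s * L s * F (φ s) + P s * (deriv F (φ s) * (-4 / (1 - 2 * s) ^ 3))) s :=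
    fun {s} h1 h2 h3 => (hasDerivAt_cpow_mul_cpow μ (ν - μ) h1 h2).fun_mul
      (h3.differentiableAt.hasDerivAt.comp s
        (hasDerivAt_quadraticArgument (slitPlane_ne_zero h2)))
  have ev : deriv (fun t => P t * F (φ t)) =ᶠ[𝓝 t] fun s =>
      P s * L s * F (φ s) + P s * (deriv F (φ s) * (-4 / (1 - 2 * s) ^ 3)) := by
    have c1 : ContinuousAt (fun s : ℂ => 1 - s) t := by fun_prop
    have c2 : ContinuousAt (fun s : ℂ => 1 - 2 * s) t := by fun_prop
    filter_upwards [c1.eventually_mem (isOpen_slitPlane.mem_nhds h1),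
      c2.eventually_mem (isOpen_slitPlane.mem_nhds h2),
      hφc.eventually hF.eventually_analyticAt] with s s1 s2 s3
    exact (dF s1 s2 s3).deriv
  have dP := hasDerivAt_cpow_mul_cpow μ (ν - μ) h1 h2
  have dL : HasDerivAt L (-μ / (1 - t) ^ 2 - 4 * (ν - μ) / (1 - 2 * t) ^ 2) t := by
    have := ((hasDerivAt_const t (-μ)).fun_div ((hasDerivAt_id' t).const_sub 1) n1).fun_sub
      ((hasDerivAt_const t (2 * (ν - μ))).fun_div
        (((hasDerivAt_id' t).const_mul 2).const_sub 1) n2)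
    refine this.congr_deriv ?_
    field_simp
    ring
  have dq : HasDerivAt (fun s : ℂ => -4 / (1 - 2 * s) ^ 3) (-24 / (1 - 2 * t) ^ 4) t := by
    have := (hasDerivAt_const t (-4 : ℂ)).fun_div
      ((((hasDerivAt_id' t).const_mul 2).const_sub 1).fun_pow 3) (pow_ne_zero 3 n2)
    refine this.congr_deriv ?_
    field_simp
    ring
  have dφ := hasDerivAt_quadraticArgument n2
  have d0 := hF.differentiableAt.hasDerivAt.comp t dφ
  have d1 := hF.deriv.differentiableAt.hasDerivAt.comp t dφ
  have dd := ((dP.fun_mul dL).fun_mul d0).fun_add (dP.fun_mul (d1.fun_mul dq))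
  have e2 : deriv (deriv (fun t => P t * F (φ t))) t = _ :=
    ev.deriv_eq.trans dd.deriv
  have e1 := (dF h1 h2 hF).deriv
  rw [GaussODE] at ode ⊢
  rw [e2, e1]
  change φ t * (1 - φ t) * deriv (deriv F) (φ t) + _ * deriv F (φ t) - _ * F (φ t) = 0 at ode
  simp only [Function.comp_apply]
  change t * (1 - t) * (((P t * L t) * L t + P t * _) * F (φ t) +
    P t * L t * (deriv F (φ t) * _) + ((P t * L t) * (deriv F (φ t) * _) +
      P t * (deriv (deriv F) (φ t) * _ * _ + deriv F (φ t) * _))) + _ - _ = 0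
  have hφt : φ t = -4 * t * (1 - t) / (1 - 2 * t) ^ 2 := rfl
  have hLt : L t = -μ / (1 - t) - 2 * (ν - μ) / (1 - 2 * t) := rfl
  -- `k2`, `k1`, `k0` compare the coefficients of F'', F' and F: each is -4/(1-2t)² times its
  -- counterpart in the equation for F.
  have k2 : t * (1 - t) * (-4 / (1 - 2 * t) ^ 3) * (-4 / (1 - 2 * t) ^ 3) =
      -4 / (1 - 2 * t) ^ 2 * (φ t * (1 - φ t)) := by
    rw [hφt]
    clear * - n1 n2
    generalize hs : 1 - 2 * t = s at *
    generalize hr : 1 - t = r at *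
    field_simp
    rw [← hs, ← hr]
    ring
  have k1 : t * (1 - t) * (2 * L t * (-4 / (1 - 2 * t) ^ 3) + -24 / (1 - 2 * t) ^ 4) +
      (μ + 1 - (-ν + (ν + 1) + 1) * t) * (-4 / (1 - 2 * t) ^ 3) =
      -4 / (1 - 2 * t) ^ 2 * (μ + 1 - ((μ - ν) / 2 + (μ - ν + 1) / 2 + 1) * φ t) := by
    rw [hφt, hLt]
    clear * - n1 n2
    generalize hs : 1 - 2 * t = s at *
    generalize hr : 1 - t = r at *
    field_simp
    rw [← hs, ← hr]
    ring
  have k0 : t * (1 - t) * (L t * L t + (-μ / (1 - t) ^ 2 - 4 * (ν - μ) / (1 - 2 * t) ^ 2)) +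
      (μ + 1 - (-ν + (ν + 1) + 1) * t) * L t - -ν * (ν + 1) =
      -4 / (1 - 2 * t) ^ 2 * -((μ - ν) / 2 * ((μ - ν + 1) / 2)) := by
    rw [hLt]
    clear * - n1 n2
    generalize hs : 1 - 2 * t = s at *
    generalize hr : 1 - t = r at *
    field_simp
    rw [← hs, ← hr]
    ring
  linear_combination P t * deriv (deriv F) (φ t) * k2 + P t * deriv F (φ t) * k1 +
    P t * F (φ t) * k0 - 4 / (1 - 2 * t) ^ 2 * P t * ode

/-! ### Leading coefficients and the transformation near the origin -/

theorem ascPochhammer_eval_add (x : ℂ) (N n : ℕ) : (ascPochhammer ℂ (N + n)).eval x =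
    (ascPochhammer ℂ N).eval x * (ascPochhammer ℂ n).eval (x + N) := by
  rw [← ascPochhammer_mul]; simp [Polynomial.eval_comp]

theorem ascPochhammer_eval_two_mul (x : ℂ) (N : ℕ) : (ascPochhammer ℂ (2 * N)).eval x =
    4 ^ N * ((ascPochhammer ℂ N).eval (x / 2) * (ascPochhammer ℂ N).eval ((x + 1) / 2)) := by
  induction N with
  | zero => simp
  | succ N ih =>
    rw [Nat.mul_succ, ascPochhammer_succ_eval, ascPochhammer_succ_eval, ih,
      ascPochhammer_succ_eval, ascPochhammer_succ_eval]
    push_cast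
    ring

theorem ascPochhammer_eval_sub (x : ℂ) (N : ℕ) : (ascPochhammer ℂ N).eval (-N - x) =
    (-1) ^ N * (ascPochhammer ℂ N).eval (x + 1) := by
  have := ascPochhammer_eval_neg_eq_descPochhammer ℂ (x + N) N
  rw [descPochhammer_eval_eq_ascPochhammer] at this
  rw [show -(N : ℂ) - x = -(x + N) by ring, this]
  ring_nf

/-- Matches the leading coefficients when μ = -N; (-4)^N comes from -4t(1-t)/(1-2t)² ~ -4t.
Duplication makes the left product (-N-ν)_{2N} up to sign, which splits at N, and reflection turns
its first half into (ν+1)_N. -/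
theorem ascPochhammer_eval_quadratic (ν : ℂ) (N : ℕ) :
    (-4) ^ N * ((ascPochhammer ℂ N).eval ((-N - ν) / 2) *
      (ascPochhammer ℂ N).eval ((-N - ν + 1) / 2)) =
    (ascPochhammer ℂ N).eval (-ν) * (ascPochhammer ℂ N).eval (ν + 1) := by
  have h1 := ascPochhammer_eval_two_mul (-N - ν) N
  rw [two_mul, ascPochhammer_eval_add, ascPochhammer_eval_sub,
    show -(N : ℂ) - ν + N = -ν by ring] at h1
  have h3 : ((-1 : ℂ) ^ N) * (-1) ^ N = 1 := by rw [← mul_pow]; simp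
  rw [show (-4 : ℂ) = -1 * 4 by norm_num, mul_pow, mul_assoc, ← h1]
  linear_combination ((ascPochhammer ℂ N).eval (-ν) * (ascPochhammer ℂ N).eval (ν + 1)) * h3

theorem regularizedGaussHGFun_zero (a b c : ℂ) : regularizedGaussHGFun a b c 0 = (Gamma c)⁻¹ := by
  have h := hasSum_of_hasFPowerSeriesOnBall (hasFPowerSeriesOnBall_regularizedGaussHGFun a b c)
    (z := 0) (by simp)
  have h2 := hasSum_single (f := fun n => (regularizedGaussHGFunSeries a b c).coeff n * 0 ^ n) 0
    (fun n hn => by simp [hn])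
  rw [h.unique h2, coeff_regularizedGaussHGFunSeries]
  simp

/-- The first N terms vanish because 1/Γ(1-N+n) = 0 for n < N; the rest is an index shift. -/
theorem regularizedGaussHGFun_one_sub (a b : ℂ) (N : ℕ) {z : ℂ} (hz : ‖z‖ < 1) :
    regularizedGaussHGFun a b (1 - N) z = z ^ N * ((ascPochhammer ℂ N).eval a *
      (ascPochhammer ℂ N).eval b * regularizedGaussHGFun (a + N) (b + N) (1 + N) z) := by
  have h1 := hasSum_of_hasFPowerSeriesOnBall
    (hasFPowerSeriesOnBall_regularizedGaussHGFun a b (1 - N)) hz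
  have h2 := hasSum_of_hasFPowerSeriesOnBall
    (hasFPowerSeriesOnBall_regularizedGaussHGFun (a + N) (b + N) (1 + N)) hz
  have h3 := (h2.mul_left ((ascPochhammer ℂ N).eval a * (ascPochhammer ℂ N).eval b)).mul_left
    (z ^ N)
  refine h1.unique ((hasSum_nat_add_iff' N).1 ?_)
  convert! h3 using 1
  · ext n
    simp only [coeff_regularizedGaussHGFunSeries]
    rw [add_comm n N, ascPochhammer_eval_add, ascPochhammer_eval_add, pow_add]
    have e1 : Gamma (1 - N + (N + n : ℕ)) = n.factorial := by
      rw [← Gamma_nat_eq_factorial]; push_cast; ring_nf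
    have e2 : Gamma (1 + N + n) = (N + n).factorial := by
      rw [← Gamma_nat_eq_factorial]; push_cast; ring_nf
    rw [e1, e2]
    ring
  · rw [Finset.sum_eq_zero, sub_zero]
    intro n hn
    have : Gamma (1 - N + n) = 0 := by
      rw [Gamma_eq_zero_iff]
      exact ⟨N - 1 - n, by have := Finset.mem_range.1 hn; push_cast [Nat.sub_sub, Nat.cast_sub (show 1 + n ≤ N by omega)]; ring⟩
    simp [coeff_regularizedGaussHGFunSeries, this]

/-- The quadratic transformation near the origin. -/
theorem regularizedGaussHGFun_quadratic (ν μ : ℂ) : ∀ᶠ t in 𝓝 (0 : ℂ),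
    regularizedGaussHGFun (-ν) (ν + 1) (μ + 1) t =
      (1 - t) ^ μ * (1 - 2 * t) ^ (ν - μ) *
        regularizedGaussHGFun ((μ - ν) / 2) ((μ - ν + 1) / 2) (μ + 1)
          (-4 * t * (1 - t) / (1 - 2 * t) ^ 2) := by
  have hφ : AnalyticAt ℂ (fun t : ℂ => -4 * t * (1 - t) / (1 - 2 * t) ^ 2) 0 := by
    fun_prop (disch := simp)
  have hP : AnalyticAt ℂ (fun t : ℂ => (1 - t) ^ μ * (1 - 2 * t) ^ (ν - μ)) 0 := by
    fun_prop (disch := simp)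
  have hφ1 : ∀ᶠ t in 𝓝 (0 : ℂ), ‖-4 * t * (1 - t) / (1 - 2 * t) ^ 2‖ < 1 := by
    have := hφ.continuousAt.norm.eventually_lt_const (u := 1)
    simpa using this
  have hball : ∀ᶠ t in 𝓝 (0 : ℂ), ‖t‖ < 1 := by
    have := (continuous_norm (E := ℂ)).continuousAt (x := 0) |>.eventually_lt_const (u := 1)
    simpa using this
  have hs1 : ∀ᶠ t in 𝓝 (0 : ℂ), 1 - t ∈ slitPlane :=
    ContinuousAt.eventually_mem (by fun_prop) (isOpen_slitPlane.mem_nhds (by simp))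
  have hs2 : ∀ᶠ t in 𝓝 (0 : ℂ), 1 - 2 * t ∈ slitPlane :=
    ContinuousAt.eventually_mem (by fun_prop) (isOpen_slitPlane.mem_nhds (by simp))
  have ode₁ : ∀ᶠ t in 𝓝 (0 : ℂ), GaussODE (-ν) (ν + 1) (μ + 1)
      (regularizedGaussHGFun (-ν) (ν + 1) (μ + 1)) t :=
    hball.mono fun t ht => gaussODE_regularizedGaussHGFun _ _ _ ht
  have ode₂ : ∀ᶠ t in 𝓝 (0 : ℂ), GaussODE (-ν) (ν + 1) (μ + 1)
      (fun t => (1 - t) ^ μ * (1 - 2 * t) ^ (ν - μ) *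
        regularizedGaussHGFun ((μ - ν) / 2) ((μ - ν + 1) / 2) (μ + 1)
          (-4 * t * (1 - t) / (1 - 2 * t) ^ 2)) t := by
    filter_upwards [hφ1, hs1, hs2] with t h1 h2 h3
    exact GaussODE.quadratic h2 h3 (analyticAt_regularizedGaussHGFun _ _ _ h1)
      (gaussODE_regularizedGaussHGFun _ _ _ h1)
  have hcomp : ∀ a b c : ℂ, AnalyticAt ℂ (fun t : ℂ =>
      regularizedGaussHGFun a b c (-4 * t * (1 - t) / (1 - 2 * t) ^ 2)) 0 := fun a b c =>
    AnalyticAt.fun_comp (analyticAt_regularizedGaussHGFun a b c (by simp)) hφ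
  by_cases hc : ∀ k : ℕ, μ + 1 ≠ -k
  · refine GaussODE.eventuallyEq (N := 0) (fun k _ => hc k)
      (analyticAt_regularizedGaussHGFun (-ν) (ν + 1) (μ + 1) (by simp)) (hP.mul (hcomp ((μ - ν) / 2) ((μ - ν + 1) / 2) (μ + 1)))
      (by simp) (.of_forall fun t => by rw [pow_zero, one_mul]; rfl) ?_ ode₁ ode₂
    simp [regularizedGaussHGFun_zero]
  · push Not at hc
    obtain ⟨k, hk⟩ := hc
    -- Now c = 1 - N, the exponents are 0 and N, and the values at 0 no longer determine the
    -- solutions; the coefficients of t^N do.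
    obtain ⟨N, hN⟩ : ∃ N, N = k + 1 := ⟨_, rfl⟩
    have hμ : μ = -N := by rw [hN]; push_cast; linear_combination hk
    have hμ1 : μ + 1 = 1 - N := by rw [hμ]; ring
    have hψ : AnalyticAt ℂ (fun t : ℂ => (-4 * (1 - t) / (1 - 2 * t) ^ 2) ^ N) 0 := by
      fun_prop (disch := simp)
    refine GaussODE.eventuallyEq (N := N) ?_
      ((analyticAt_const (v := (ascPochhammer ℂ N).eval (-ν) * (ascPochhammer ℂ N).eval (ν + 1))).mul
        (analyticAt_regularizedGaussHGFun (-ν + N) (ν + 1 + N) (1 + N)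
        (by simp)))
      (hP.mul (hψ.mul ((analyticAt_const (v := (ascPochhammer ℂ N).eval ((μ - ν) / 2) *
        (ascPochhammer ℂ N).eval ((μ - ν + 1) / 2))).mul
        (hcomp ((μ - ν) / 2 + N) ((μ - ν + 1) / 2 + N) (1 + N)))))
      (hball.mono fun t ht => ?_) (hφ1.mono fun t ht => ?_) ?_ ode₁ ode₂
    · intro j hj h
      rw [hk, neg_inj] at h
      have : k = j := by exact_mod_cast h
      omega
    · rw [hμ1, regularizedGaussHGFun_one_sub _ _ _ ht]
      rfl
    · rw [hμ1, regularizedGaussHGFun_one_sub _ _ _ ht]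
      simp only [Pi.mul_apply]
      rw [show -4 * t * (1 - t) / (1 - 2 * t) ^ 2 = t * (-4 * (1 - t) / (1 - 2 * t) ^ 2) by ring,
        mul_pow]
      ring
    · simp only [Pi.mul_apply]
      have := ascPochhammer_eval_quadratic ν N
      rw [hμ]
      simp only [mul_zero, sub_zero, one_cpow, mul_one, one_pow, div_one,
        regularizedGaussHGFun_zero]
      rw [← this]
      ring

/-! ### Continuation along the segment and the formula on (0,1) -/

/-- On the cut plane, `x = (1 - z)^{-1/2}` is the inverse of `z = 1 - 1 / x²`. -/
theorem isRadialValue_quadratic (ν μ : ℂ) {x : ℝ} (hx : x ∈ Set.Ioo (0 : ℝ) 1) :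
    IsRadialValue (regularizedGaussHGFun ((μ - ν) / 2) ((μ - ν + 1) / 2) (μ + 1))
      ((1 - 1 / x ^ 2 : ℝ) : ℂ)
      (regularizedGaussHGFun (-ν) (ν + 1) (μ + 1) (((1 - x) / 2 : ℝ) : ℂ) *
        (((1 + x) / 2 : ℝ) : ℂ) ^ (-μ) * (x : ℂ) ^ (μ - ν)) := by
  set X : ℂ → ℂ := fun z => (1 - z) ^ (-(1 / 2) : ℂ) with hX
  have hXr : ∀ y : ℝ, 0 < y → X ((1 - 1 / y ^ 2 : ℝ) : ℂ) = y := by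
    intro y hy
    have h1 : (1 : ℂ) - ((1 - 1 / y ^ 2 : ℝ) : ℂ) = ((y ^ (-2 : ℝ) : ℝ) : ℂ) := by
      rw [Real.rpow_neg hy.le, Real.rpow_two]
      push_cast; ring
    have h2 : (-(1 / 2) : ℂ) = ((-(1 / 2) : ℝ) : ℂ) := by push_cast; ring
    simp only [hX]
    rw [h1, h2, ← ofReal_cpow (by positivity), ← Real.rpow_mul hy.le]
    norm_num
  have hX0 : X 0 = 1 := by simp [hX]
  have hXa : ∀ z, 1 - z ∈ slitPlane → AnalyticAt ℂ X z := fun z hz => by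
    fun_prop (disch := assumption)
  -- The transformation at t = (1 - X z)/2, solved for the function of z.
  refine ⟨fun z => regularizedGaussHGFun (-ν) (ν + 1) (μ + 1) ((1 - X z) / 2) *
    ((1 + X z) / 2) ^ (-μ) * X z ^ (μ - ν), ?_, ?_, ?_⟩
  · intro z hz
    -- Points of the segment are 1 - 1/y² with 0 < y ≤ 1. There X = y, so (1 - X)/2 lies in the unit
    -- disc and both power bases are positive.
    obtain ⟨y, hy0, hy1, rfl⟩ : ∃ y : ℝ, 0 < y ∧ y ≤ 1 ∧ ((1 - 1 / y ^ 2 : ℝ) : ℂ) = z := by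
      rw [segment_eq_image'] at hz
      obtain ⟨θ, hθ, rfl⟩ := hz
      have hs : 0 ≤ θ * (1 / x ^ 2 - 1) := by
        refine mul_nonneg hθ.1 (sub_nonneg.2 ?_)
        rw [le_div_iff₀ (pow_pos hx.1 2)]
        nlinarith [hx.1, hx.2]
      refine ⟨(√(1 + θ * (1 / x ^ 2 - 1)))⁻¹, by positivity, ?_, ?_⟩
      · apply inv_le_one_of_one_le₀
        rw [Real.one_le_sqrt]
        linarith
      · rw [inv_pow, Real.sq_sqrt (by positivity)]
        simp only [one_div, inv_inv, zero_add, sub_zero, real_smul]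
        push_cast
        ring
    have hzs : (1 : ℂ) - ((1 - 1 / y ^ 2 : ℝ) : ℂ) ∈ slitPlane := by
      rw [← ofReal_one, ← ofReal_sub, ofReal_mem_slitPlane]
      have : 0 < 1 / y ^ 2 := by positivity
      linarith
    have hXz := hXa _ hzs
    have e := hXr y hy0
    have a1 : AnalyticAt ℂ (fun z => (1 - X z) / 2) ((1 - 1 / y ^ 2 : ℝ) : ℂ) := by fun_prop
    have a2 : AnalyticAt ℂ (fun z => (1 + X z) / 2) ((1 - 1 / y ^ 2 : ℝ) : ℂ) := by fun_prop
    refine ((AnalyticAt.fun_comp (analyticAt_regularizedGaussHGFun _ _ _ ?_) a1).mul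
      (a2.cpow analyticAt_const ?_)).mul (hXz.cpow analyticAt_const ?_)
    · rw [e, show (1 - (y : ℂ)) / 2 = (((1 - y) / 2 : ℝ) : ℂ) by push_cast; ring, norm_real,
        Real.norm_eq_abs, abs_lt]
      constructor <;> linarith
    · rw [e, show (1 + (y : ℂ)) / 2 = (((1 + y) / 2 : ℝ) : ℂ) by push_cast; ring,
        ofReal_mem_slitPlane]
      linarith
    · rw [e, ofReal_mem_slitPlane]
      exact hy0
  · have c0 : ContinuousAt X 0 := (hXa 0 (by simp)).continuousAt
    have ht : Tendsto (fun z => (1 - X z) / 2) (𝓝 0) (𝓝 0) := by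
      have : ContinuousAt (fun z => (1 - X z) / 2) 0 := by fun_prop
      have := this.tendsto
      simpa [hX0] using this
    have c1 : ∀ᶠ z in 𝓝 (0 : ℂ), 1 - z ∈ slitPlane :=
      ContinuousAt.eventually_mem (by fun_prop) (isOpen_slitPlane.mem_nhds (by simp))
    have c2 : ∀ᶠ z in 𝓝 (0 : ℂ), (1 + X z) / 2 ∈ slitPlane :=
      ContinuousAt.eventually_mem (by fun_prop) (isOpen_slitPlane.mem_nhds (by simp [hX0]))
    filter_upwards [ht.eventually (regularizedGaussHGFun_quadratic ν μ), c1, c2] with z h1 h2 h3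
    have n2 := slitPlane_ne_zero h2
    have n3 := slitPlane_ne_zero h3
    have nX : X z ≠ 0 := by simp [hX, cpow_eq_zero_iff, n2]
    have hsq : X z ^ 2 = (1 - z)⁻¹ := by
      simp only [hX]
      rw [← cpow_nat_mul, ← cpow_neg_one]
      norm_num
    have hz : -4 * ((1 - X z) / 2) * (1 - (1 - X z) / 2) / (1 - 2 * ((1 - X z) / 2)) ^ 2 = z := by
      rw [show 1 - 2 * ((1 - X z) / 2) = X z by ring,
        show -4 * ((1 - X z) / 2) * (1 - (1 - X z) / 2) = X z ^ 2 - 1 by ring, hsq]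
      field_simp
      ring
    rw [hz, show 1 - (1 - X z) / 2 = (1 + X z) / 2 by ring,
      show 1 - 2 * ((1 - X z) / 2) = X z by ring] at h1
    have p1 : ((1 + X z) / 2) ^ μ * ((1 + X z) / 2) ^ (-μ) = 1 := by
      rw [← cpow_add _ _ n3]; simp
    have p2 : X z ^ (ν - μ) * X z ^ (μ - ν) = 1 := by
      rw [← cpow_add _ _ nX]; simp
    rw [h1]
    linear_combination (regularizedGaussHGFun ((μ - ν) / 2) ((μ - ν + 1) / 2) (μ + 1) z) *
      (X z ^ (ν - μ) * X z ^ (μ - ν) * p1 + p2)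
  · simp only
    rw [hXr x hx.1]
    push_cast
    rfl

theorem ferrersP_eq (ν μ : ℂ) {x : ℝ} (hx : x ∈ Set.Ioo (-1 : ℝ) 1) :
    ferrersP ν μ x = (((1 - x) / (1 + x) : ℝ) : ℂ) ^ (μ / 2) *
      regularizedGaussHGFun (-ν) (ν + 1) (μ + 1) (((1 - x) / 2 : ℝ) : ℂ) := by
  rw [ferrersP, hypOverGamma_eq_series]
  rw [norm_real, Real.norm_eq_abs, abs_lt]
  constructor <;> linarith [hx.1, hx.2]

theorem ferrersP_eq_quadraticRepr (ν μ : ℂ) {x : ℝ} (hx : x ∈ Set.Ioo (0 : ℝ) 1) :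
    ferrersP ν μ x = quadraticRepr ν μ x := by
  obtain ⟨h0, h1⟩ := hx
  rw [ferrersP_eq ν μ ⟨by linarith, h1⟩, quadraticRepr, hypOverGamma,
    (isRadialValue_quadratic ν μ ⟨h0, h1⟩).eq]
  have hx0 : (x : ℂ) ≠ 0 := by exact_mod_cast h0.ne'
  have p2 : (x : ℂ) ^ (ν - μ) * (x : ℂ) ^ (μ - ν) = 1 := by
    rw [← cpow_add _ _ hx0]; simp
  -- Principal powers multiply here because all bases are nonnegative reals.
  have hp : (((1 - x) / (1 + x) : ℝ) : ℂ) ^ (μ / 2) =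
      ((1 - x ^ 2 : ℝ) : ℂ) ^ (μ / 2) / (2 : ℂ) ^ μ * (((1 + x) / 2 : ℝ) : ℂ) ^ (-μ) := by
    have q0 : (0 : ℝ) ≤ (1 - x) / (1 + x) := div_nonneg (by linarith) (by linarith)
    have hn : (((1 + x : ℝ)) : ℂ) ^ μ ≠ 0 := by
      rw [Ne, cpow_eq_zero_iff, not_and_or]
      left
      exact_mod_cast (by linarith : (1 + x : ℝ) ≠ 0)
    have h2 : (2 : ℂ) ^ μ ≠ 0 := by simp [cpow_eq_zero_iff]
    have e1 : (1 - x ^ 2 : ℝ) = (1 - x) / (1 + x) * (1 + x) ^ 2 := by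
      have : (1 + x : ℝ) ≠ 0 := by linarith
      field_simp; ring
    have e2 : (((1 + x) ^ 2 : ℝ) : ℂ) ^ (μ / 2) = ((1 + x : ℝ) : ℂ) ^ μ := by
      rw [sq, ofReal_mul, mul_cpow_ofReal_nonneg (by linarith) (by linarith), ← cpow_add]
      · ring_nf
      · exact_mod_cast (by linarith : (1 + x : ℝ) ≠ 0)
    rw [e1, ofReal_mul, mul_cpow_ofReal_nonneg q0 (by positivity), e2,
      show (1 + x) / 2 = (1 + x) * 2⁻¹ by ring, ofReal_mul,
      mul_cpow_ofReal_nonneg (by linarith) (by norm_num), cpow_neg, cpow_neg, ofReal_inv,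
      ofReal_ofNat, inv_cpow _ _ (by rw [show (2 : ℂ) = ((2 : ℝ) : ℂ) by simp,
        arg_ofReal_of_nonneg (by norm_num)]; exact Real.pi_ne_zero.symm)]
    field_simp
  rw [hp]
  linear_combination (-((1 - x ^ 2 : ℝ) : ℂ) ^ (μ / 2) / (2 : ℂ) ^ μ *
    (((1 + x) / 2 : ℝ) : ℂ) ^ (-μ) *
    regularizedGaussHGFun (-ν) (ν + 1) (μ + 1) (((1 - x) / 2 : ℝ) : ℂ)) * p2

/-! ### Analyticity in x and continuation to (-1,1) -/

theorem analyticAt_ofReal_comp {f : ℝ → ℝ} {x : ℝ} (hf : AnalyticAt ℝ f x) :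
    AnalyticAt ℝ (fun y => (f y : ℂ)) x :=
  AnalyticAt.fun_comp (ofRealCLM.analyticAt _) hf

theorem analyticAt_ofReal_cpow {f : ℝ → ℝ} {x : ℝ} (hf : AnalyticAt ℝ f x) (hx : 0 < f x) (κ : ℂ) :
    AnalyticAt ℝ (fun y => (f y : ℂ) ^ κ) x := by
  have : AnalyticAt ℂ (fun z : ℂ => z ^ κ) (f x : ℂ) :=
    analyticAt_id.cpow analyticAt_const (ofReal_mem_slitPlane.2 hx)
  exact AnalyticAt.fun_comp (f := fun y => (f y : ℂ)) (this.restrictScalars (𝕜 := ℝ)) (analyticAt_ofReal_comp hf)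

/-- The argument (1-x)/2 stays in the unit disc for all x in (-1,1), whereas 1 - 1/x² blows up at x
= 0. -/
theorem analyticOnNhd_ferrersP (ν μ : ℂ) : AnalyticOnNhd ℝ (ferrersP ν μ) (Set.Ioo (-1) 1) := by
  intro x hx
  have h1 : (1 + x : ℝ) ≠ 0 := by linarith [hx.1]
  have a1 : AnalyticAt ℝ (fun x : ℝ => (1 - x) / (1 + x)) x := by
    fun_prop (disch := assumption)
  have a2 : AnalyticAt ℝ (fun x : ℝ => (1 - x) / 2) x := by fun_prop
  have n : ‖(((1 - x) / 2 : ℝ) : ℂ)‖ < 1 := by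
    rw [norm_real, Real.norm_eq_abs, abs_lt]
    constructor <;> linarith [hx.1, hx.2]
  refine ((analyticAt_ofReal_cpow a1 (div_pos (by linarith [hx.2]) (by linarith [hx.1]))
    (μ / 2)).mul (AnalyticAt.fun_comp ((analyticAt_regularizedGaussHGFun (-ν) (ν + 1) (μ + 1)
      n).restrictScalars (𝕜 := ℝ)) (analyticAt_ofReal_comp a2))).congr ?_
  filter_upwards [Ioo_mem_nhds hx.1 hx.2] with y hy
  exact (ferrersP_eq ν μ hy).symm

theorem IsContinuation.ferrersP_eq {ν μ : ℂ} {R : ℝ → ℂ}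
    (hR : IsContinuation (quadraticRepr ν μ) R) :
    Set.EqOn (ferrersP ν μ) R (Set.Ioo (-1) 1) := by
  refine (analyticOnNhd_ferrersP ν μ).eqOn_of_preconnected_of_eventuallyEq hR.1
    isPreconnected_Ioo (z₀ := 1 / 2) (by norm_num) ?_
  filter_upwards [Ioo_mem_nhds (show (0 : ℝ) < 1 / 2 by norm_num)
    (show (1 / 2 : ℝ) < 1 by norm_num)] with y hy
  rw [ferrersP_eq_quadraticRepr ν μ hy, hR.2 hy]

/-! ### The terminating case -/

/-- A polynomial is entire, so it is its own continuation to every z, even outside the unit disc. -/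
theorem hypOverGamma_eq_sum {a b c : ℂ} {m : ℕ}
    (h : ∀ n, m < n → (regularizedGaussHGFunSeries a b c).coeff n = 0) (z : ℂ) :
    hypOverGamma a b c z =
      ∑ k ∈ Finset.range (m + 1), (regularizedGaussHGFunSeries a b c).coeff k * z ^ k := by
  refine IsRadialValue.eq ⟨fun z => ∑ k ∈ Finset.range (m + 1),
    (regularizedGaussHGFunSeries a b c).coeff k * z ^ k, fun z _ => by fun_prop, ?_, rfl⟩
  filter_upwards [Metric.ball_mem_nhds (0 : ℂ) one_pos] with w hw
  refine (hasSum_sum_of_ne_finset_zero fun n hn => ?_).unique (hasSum_of_hasFPowerSeriesOnBall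
    (hasFPowerSeriesOnBall_regularizedGaussHGFun a b c) (by simpa using hw))
  rw [h n (by simpa [Nat.lt_succ_iff] using hn), zero_mul]

/-- One upper parameter is -⌊n/2⌋: the first for even n, the second for odd n. -/
theorem coeff_eq_zero_of_sub_eq_natCast {ν μ : ℂ} {n : ℕ} (h : ν - μ = n) (k : ℕ) (hk : n / 2 < k) :
    (regularizedGaussHGFunSeries ((μ - ν) / 2) ((μ - ν + 1) / 2) (μ + 1)).coeff k = 0 := by
  rw [coeff_regularizedGaussHGFunSeries]
  have h' : μ - ν = -n := by linear_combination -h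
  have hz := ascPochhammer_eval_neg_coe_nat_of_lt (R := ℂ) hk
  rcases Nat.even_or_odd' n with ⟨m, rfl | rfl⟩
  · rw [show 2 * m / 2 = m by omega] at hz
    rw [show (μ - ν) / 2 = -(m : ℂ) by rw [h']; push_cast; ring, hz]
    simp
  · rw [show (2 * m + 1) / 2 = m by omega] at hz
    rw [show (μ - ν + 1) / 2 = -(m : ℂ) by rw [h']; push_cast; ring, hz]
    simp

/-- If `ν - μ = n`, then the right side is a polynomial times `(1 - x²)^{μ/2}`. -/
theorem quadraticRepr_eq_sum {ν μ : ℂ} {n : ℕ} (h : ν - μ = n) {x : ℝ} (hx : x ≠ 0) :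
    quadraticRepr ν μ x = ((1 - x ^ 2 : ℝ) : ℂ) ^ (μ / 2) / (2 : ℂ) ^ μ *
      ∑ k ∈ Finset.range (n / 2 + 1),
        (regularizedGaussHGFunSeries ((μ - ν) / 2) ((μ - ν + 1) / 2) (μ + 1)).coeff k *
          ((x ^ (n - 2 * k) * (x ^ 2 - 1) ^ k : ℝ) : ℂ) := by
  rw [quadraticRepr, hypOverGamma_eq_sum (coeff_eq_zero_of_sub_eq_natCast h), h, cpow_natCast,
    mul_div_assoc, mul_comm ((x : ℂ) ^ n), mul_assoc, Finset.mul_sum]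
  congr 1
  refine Finset.sum_congr rfl fun k hk => ?_
  have hk' : 2 * k ≤ n := by have := Finset.mem_range.1 hk; omega
  -- Since 2k ≤ n, the power x^n absorbs the pole of (1 - 1/x²)^k at 0.
  have e : x ^ n * (1 - 1 / x ^ 2) ^ k = x ^ (n - 2 * k) * (x ^ 2 - 1) ^ k := by
    rw [show x ^ n = x ^ (n - 2 * k) * (x ^ 2) ^ k by rw [← pow_mul, ← pow_add]; congr 1; omega,
      mul_assoc, ← mul_pow]
    congr 2
    field_simp
  rw [← e]
  push_cast
  ring

/-- The finite-sum form is analytic on (-1,1), including 0, so it is a continuation. It also equals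
the formula at negative x, since x^(ν-μ) is an integer power with no branch to choose. -/
theorem ferrersP_eq_quadraticRepr_of_sub_eq_natCast {ν μ : ℂ} {n : ℕ} (h : ν - μ = n) {x : ℝ}
    (hx : x ∈ Set.Ioo (-1 : ℝ) 1) (hx0 : x ≠ 0) : ferrersP ν μ x = quadraticRepr ν μ x := by
  rw [quadraticRepr_eq_sum h hx0]
  refine IsContinuation.ferrersP_eq (R := fun x => ((1 - x ^ 2 : ℝ) : ℂ) ^ (μ / 2) / (2 : ℂ) ^ μ *
      ∑ k ∈ Finset.range (n / 2 + 1),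
        (regularizedGaussHGFunSeries ((μ - ν) / 2) ((μ - ν + 1) / 2) (μ + 1)).coeff k *
          ((x ^ (n - 2 * k) * (x ^ 2 - 1) ^ k : ℝ) : ℂ)) ⟨fun y hy => ?_, fun y hy => ?_⟩ hx
  · have a1 : AnalyticAt ℝ (fun x : ℝ => 1 - x ^ 2) y := by fun_prop
    have hy1 : 0 < 1 - y ^ 2 := by nlinarith [hy.1, hy.2]
    refine (((analyticAt_ofReal_cpow a1 hy1 (μ / 2)).fun_mul
      (analyticAt_const (v := ((2 : ℂ) ^ μ)⁻¹)))).fun_mul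
      (Finset.analyticAt_fun_sum _ fun k _ => ?_)
    exact analyticAt_const.mul (analyticAt_ofReal_comp (by fun_prop))
  · exact (quadraticRepr_eq_sum h hy.1.ne').symm

end Ferrers

theorem mainTheorem8 (ν μ : ℂ) :
    (∀ x ∈ Set.Ioo (0 : ℝ) 1, Ferrers.ferrersP ν μ x = Ferrers.quadraticRepr ν μ x) ∧
    ((∃ R : ℝ → ℂ, Ferrers.IsContinuation (Ferrers.quadraticRepr ν μ) R) ∧
      ∀ R : ℝ → ℂ, Ferrers.IsContinuation (Ferrers.quadraticRepr ν μ) R →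
        ∀ x ∈ Set.Ioo (-1 : ℝ) 1, Ferrers.ferrersP ν μ x = R x) ∧
    ((∃ n : ℕ, ν - μ = n) →
      ∀ x ∈ Set.Ioo (-1 : ℝ) 1, x ≠ 0 →
        Ferrers.ferrersP ν μ x = Ferrers.quadraticRepr ν μ x) :=
  ⟨fun _ hx => Ferrers.ferrersP_eq_quadraticRepr ν μ hx,
    ⟨⟨Ferrers.ferrersP ν μ, Ferrers.analyticOnNhd_ferrersP ν μ,
      fun _ hx => Ferrers.ferrersP_eq_quadraticRepr ν μ hx⟩,
      fun _ hR _ hx => hR.ferrersP_eq hx⟩,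
    fun ⟨_, hn⟩ _ hx hx0 => Ferrers.ferrersP_eq_quadraticRepr_of_sub_eq_natCast hn hx hx0⟩
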